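/- Consider a zero-sum stochastic game with states $1,\dots,n$, finite nonempty action sets $I^k,J^k$ at state $k$, payoff $g(k,i,j)\in\mathbb R$ and transition probabilities $q(\ell\mid k,i,j)$. Fix $\lambda\in(0,1]$. Let $v_\lambda^k=\sup_\sigma\inf_\tau \mathbb E^k_{\sigma,\tau}\big[\sum_{m\ge1}\lambda(1-\lambda)^{m-1}g_m\big]$ be the value of the $\lambda$-discounted game with initial state $k$, where $\sigma,\tau$ range over all (history-dependent, mixed) strategies of Player 1 (maximiser) and Player 2, and $g_m$ is the payoff of stage $m$. For a real matrix $M$ let $\mathrm{val}(M)$ be the value of the matrix game $M$ (the row player maximises), let $\mathrm{co}(M)$ be the cofactor matrix of a square $M$ and $S(M)$ the sum of the entries of $M$. Local games: for $z\in\mathbb R^n$, $\mathcal G^k(\lambda,z)$ is the $I^k\times J^k$ matrix with entries $\lambda g(k,i,j)+(1-\lambda)\sum_\ell q(\ell\mid k,i,j)z^\ell$. Kernels: a basic solution of a matrix game $G$ is an extreme point $(x,y)$ of the product of the two players' sets of optimal mixed strategies. A square sub-matrix $\dot G$ of $G$ is a Shapley–Snow kernel if $S(\mathrm{co}(\dot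 G))\ne0$ and, for some basic solution $(x,y)$, the restrictions of $x$ and $y$ to the rows and columns of $\dot G$ are $\dot x=\mathrm{co}(\dot G)\mathbf 1/S(\mathrm{co}(\dot G))$ and $\dot y={}^t\mathrm{co}(\dot G)\mathbf 1/S(\mathrm{co}(\dot G))$. Auxiliary matrices: for $1\le k\le n$ let $M^k_0=(\lambda g(k,i,j))_{i,j}$ and, for $1\le\ell\le n$, $M^k_\ell=\big((1-\lambda)q(\ell\mid k,i,j)-\mathbf 1_{k=\ell}\big)_{i,j}$; let $D(\lambda)=(M^k_\ell)_{1\le k\le n,\,0\le\ell\le n}$. For $0\le\ell\le n$ put $\Delta^\ell=(-1)^\ell\det_\otimes D^{(\ell)}$, where $D^{(\ell)}$ is $D(\lambda)$ with the column of index $\ell$ deleted and $\det_\otimes (A^k_l)=\sum_{\sigma}\varepsilon(\sigma)\,A^1_{\sigma(1)}\otimes\cdots\otimes A^n_{\sigma(n)}$ is the Kronecker determinant. For every state $k$ choose a Shapley–Snow kernel of $\mathcal G^k(\lambda,v_\lambda)$, with rows $\dot I^k$ and columns $\dot J^k$, let $\dot M^k_\ell$ be the $\dot I^k\times\dot J^k$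 sub-matrix of $M^k_\ell$, and let $\dot\Delta^0,\dots,\dot\Delta^n$ be the auxiliary matrices obtained in the same way from the array $(\dot M^k_\ell)$. Let $E^k$ be the set of polynomials in $w$ that are determinants (up to sign) of nonempty square sub-matrices of $\Delta^k-w\Delta^0$, are not identically zero, and have degree at most $\mathrm{rank}(\dot\Delta^0)$. **Theorem.** For any such choice of kernels and every state $k$: (i) $v_\lambda^k$ is the unique $w\in\mathbb R$ with $\mathrm{val}(\dot\Delta^k-w\dot\Delta^0)=0$, and also the unique $w\in\mathbb R$ with $\mathrm{val}\big((-1)^n(\dot\Delta^k-w\dot\Delta^0)\big)=0$. (ii) $\mathrm{rank}(\dot\Delta^k-v_\lambda^k\dot\Delta^0)<\max_{w\in\mathbb R}\mathrm{rank}(\dot\Delta^k-w\dot\Delta^0)$. (iii) $E^k$ is finite and there is $P\in E^k$ with $P(v_\lambda^k)=0$. Moreover, if the discount factor is also treated as a variable, the determinants of the nonempty square sub-matrices of $\Delta^k-w\Delta^0$ form a finite set of bivariate polynomials, and some $P$ in this set satisfies $P(\lambda,\cdot)\in E^k$ and $P(\lambda,v_\lambda^k)=0$. (iv) If all the entries of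 the matrices of $D(\lambda)$ are rational, then $v_\lambda^k$ is algebraic over $\mathbb Q$ of degree at most $\mathrm{rank}(\dot\Delta^0)$. -/

import Mathlib

open Polynomial

noncomputable section

namespace StochGame

/-! ### Matrix games -/

section MatrixGames

variable {I J : Type*} [Fintype I] [Fintype J]

/-- The expected payoff `ᵗx M y` of the mixed strategies `x` and `y` in the matrix game `M`. -/
def mixedPayoff (M : Matrix I J ℝ) (x : I → ℝ) (y : J → ℝ) : ℝ :=
  ∑ i, ∑ j, x i * M i j * y j

/-- The value `max_x min_y ᵗx M y` of the matrix game `M`, Player 1 (rows) maximising. -/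
def matVal (M : Matrix I J ℝ) : ℝ :=
  ⨆ x : stdSimplex ℝ I, ⨅ y : stdSimplex ℝ J, mixedPayoff M x.1 y.1

/-- Optimal strategies of Player 1. -/
def optimalRow (M : Matrix I J ℝ) : Set (I → ℝ) :=
  {x | x ∈ stdSimplex ℝ I ∧ ∀ y ∈ stdSimplex ℝ J, matVal M ≤ mixedPayoff M x y}

/-- Optimal strategies of Player 2. -/
def optimalCol (M : Matrix I J ℝ) : Set (J → ℝ) :=
  {y | y ∈ stdSimplex ℝ J ∧ ∀ x ∈ stdSimplex ℝ I, mixedPayoff M x y ≤ matVal M}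

/-- Basic solutions: the extreme points of the product of the two sets of optimal strategies. -/
def basicSolutions (M : Matrix I J ℝ) : Set ((I → ℝ) × (J → ℝ)) :=
  Set.extremePoints ℝ (optimalRow M ×ˢ optimalCol M)

/-- The cofactor matrix: its `(a, b)` entry is `(-1) ^ (a + b)` times the determinant of `M` with
row `a` and column `b` deleted (so it is `1` for a `1 × 1` matrix). -/
def cofactorMatrix {m : ℕ} (M : Matrix (Fin m) (Fin m) ℝ) : Matrix (Fin m) (Fin m) ℝ :=
  M.adjugate.transpose

/-- The sum of the entries of a matrix. -/
def entrySum {m : ℕ} (M : Matrix (Fin m) (Fin m) ℝ) : ℝ := ∑ a, ∑ b, M a b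

/-- The square sub-matrix of `G` with rows `r 0, …, r (m - 1)` and columns `c 0, …, c (m - 1)` is a
Shapley–Snow kernel of `G`: for some basic solution `(x, y)`, writing `Ġ` for the sub-matrix, one
has `S(co Ġ) ≠ 0`, and the restrictions of `x` and `y` to the chosen rows and columns are
`co(Ġ) 𝟏 / S(co Ġ)` and `ᵗco(Ġ) 𝟏 / S(co Ġ)`. The further identities
`val G = val Ġ = det Ġ / S(co Ġ)`, `ᵗẋ Ġ = val(G) ᵗ𝟏` and `Ġ ẏ = val(G) 𝟏` are consequences, and
are not required here. The order in which rows and columns are listed is irrelevant. -/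
def IsShapleySnowKernel (G : Matrix I J ℝ) {m : ℕ} (r : Fin m ↪ I) (c : Fin m ↪ J) : Prop :=
  ∃ p ∈ basicSolutions G,
    entrySum (cofactorMatrix (G.submatrix r c)) ≠ 0 ∧
    (∀ a, p.1 (r a) = (∑ b, cofactorMatrix (G.submatrix r c) a b) /
      entrySum (cofactorMatrix (G.submatrix r c))) ∧
    (∀ b, p.2 (c b) = (∑ a, cofactorMatrix (G.submatrix r c) a b) /
      entrySum (cofactorMatrix (G.submatrix r c)))

end MatrixGames

/-! ### Kronecker determinants and auxiliary matrices

The rows of `A₁ ⊗ ⋯ ⊗ Aₙ` are indexed by tuples of rows of the factors, and likewise for columns. -/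

section Kronecker

variable {R : Type*} [CommRing R] {n : ℕ} {I J : Fin n → Type*}

/-- The Kronecker product `A₁ ⊗ ⋯ ⊗ Aₙ`. -/
def kroneckerProd (A : ∀ k, Matrix (I k) (J k) R) : Matrix (∀ k, I k) (∀ k, J k) R :=
  Matrix.of fun s t => ∏ k, A k (s k) (t k)

/-- The Kronecker determinant `∑_σ ε(σ) A¹_{σ(1)} ⊗ ⋯ ⊗ Aⁿ_{σ(n)}`. -/
def kroneckerDet (A : ∀ k, Fin n → Matrix (I k) (J k) R) : Matrix (∀ k, I k) (∀ k, J k) R :=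
  ∑ σ : Equiv.Perm (Fin n), ((Equiv.Perm.sign σ : ℤ) : R) • kroneckerProd fun k => A k (σ k)

/-- The auxiliary matrix `Δ^ℓ`: `(-1)^ℓ` times the Kronecker determinant of the array obtained from
the `n × (n + 1)` array `D` by deleting its column `ℓ` (columns are numbered from `0` to `n`). -/
def auxMatrix (D : ∀ k, Fin (n + 1) → Matrix (I k) (J k) R) (l : Fin (n + 1)) :
    Matrix (∀ k, I k) (∀ k, J k) R :=
  (-1 : R) ^ (l : ℕ) • kroneckerDet fun k a => D k (l.succAbove a)

end Kronecker

/-- The determinants, as polynomials in `w`, of all (nonempty) square sub-matrices of `A - w B`.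
Rows and columns may be listed in any order, so each determinant occurs with both signs. -/
def pencilMinors {R ι κ : Type*} [CommRing R] (A B : Matrix ι κ R) : Set R[X] :=
  {P | ∃ (m : ℕ) (r : Fin m ↪ ι) (c : Fin m ↪ κ), 0 < m ∧
    P = Matrix.det (Matrix.of fun a b => C (A (r a) (c b)) - X * C (B (r a) (c b)))}

/-! ### Stochastic games -/

/-- A zero-sum stochastic game with states `0, …, n - 1`, action sets `I k` and `J k` at state `k`,
payoff function `g` and transition function `q`. -/
structure Game (n : ℕ) (I J : Fin n → Type*) where
  g : ∀ k, I k → J k → ℝ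
  q : ∀ k, I k → J k → stdSimplex ℝ (Fin n)

section Games

variable {n : ℕ} {I J : Fin n → Type*}

/-- What happens at one stage: the state and the two actions. -/
abbrev Move (I J : Fin n → Type*) := Σ k, I k × J k

/-- Behaviour strategies with action sets `T k`: a mixed action for every finite history (the list
of past moves in chronological order, together with the current state). -/
abbrev Strategy (I J T : Fin n → Type*) [∀ k, Fintype (T k)] :=
  List (Move I J) → ∀ k, stdSimplex ℝ (T k)

namespace Game

variable [∀ k, Fintype (I k)] [∀ k, Fintype (J k)] (Γ : Game n I J)

/-- The conditional expectation, when the players use `σ` and `τ`, of the stage payoff obtained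
`t` stages after the current one, given that the past moves are `h` and the current state is `k`. -/
def stagePayoff (σ : Strategy I J I) (τ : Strategy I J J) :
    ℕ → List (Move I J) → Fin n → ℝ
  | 0, h, k => ∑ i, ∑ j, (σ h k).1 i * (τ h k).1 j * Γ.g k i j
  | t + 1, h, k => ∑ i, ∑ j, (σ h k).1 i * (τ h k).1 j *
      ∑ l, (Γ.q k i j).1 l * stagePayoff σ τ t (h ++ [⟨k, i, j⟩]) l

/-- The expected discounted payoff `𝔼[∑_{m ≥ 1} lam (1 - lam)^(m - 1) g_m]` from state `k`. -/
def payoff (lam : ℝ) (k : Fin n) (σ : Strategy I J I) (τ : Strategy I J J) : ℝ :=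
  ∑' t : ℕ, lam * (1 - lam) ^ t * Γ.stagePayoff σ τ t [] k

/-- The value `v_lam^k` of the discounted game with initial state `k`. -/
def value (lam : ℝ) (k : Fin n) : ℝ :=
  ⨆ σ : Strategy I J I, ⨅ τ : Strategy I J J, Γ.payoff lam k σ τ

end Game

namespace Game

variable (Γ : Game n I J)

/-- The local game at state `k`, with entries
`lam g(k,i,j) + (1 - lam) ∑_l q(l | k,i,j) z^l`. -/
def localGame (lam : ℝ) (z : Fin n → ℝ) (k : Fin n) : Matrix (I k) (J k) ℝ :=
  Matrix.of fun i j => lam * Γ.g k i j + (1 - lam) * ∑ l, (Γ.q k i j).1 l * z l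

/-- The `n × (n + 1)` data array `D(lam)`: in row `k`, column `0` is `lam G^k`, and the column of
state `l` is `(1 - lam) Q^k_l`, minus the all-ones matrix if `l = k`. The discount factor may be a
real number, or an element of any real algebra, such as the indeterminate of `ℝ[X]`. -/
def dataArray {A : Type*} [CommRing A] [Algebra ℝ A] (lam : A) (k : Fin n) :
    Fin (n + 1) → Matrix (I k) (J k) A :=
  Fin.cons (Matrix.of fun i j => lam * algebraMap ℝ A (Γ.g k i j))
    fun l => Matrix.of fun i j =>
      (1 - lam) * algebraMap ℝ A ((Γ.q k i j).1 l) - if l = k then 1 else 0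

/-- The auxiliary matrix `Δ^l` of the data array `D(lam)`. -/
def delta {A : Type*} [CommRing A] [Algebra ℝ A] (lam : A) (l : Fin (n + 1)) :
    Matrix (∀ k, I k) (∀ k, J k) A :=
  auxMatrix (Γ.dataArray lam) l

/-- The auxiliary matrix of the reduced array, in which the matrices of row `k` are replaced by
their sub-matrices with rows `r k` and columns `c k`. -/
def reducedDelta (lam : ℝ) {m : Fin n → ℕ} (r : ∀ k, Fin (m k) ↪ I k) (c : ∀ k, Fin (m k) ↪ J k)
    (l : Fin (n + 1)) : Matrix (∀ k, Fin (m k)) (∀ k, Fin (m k)) ℝ :=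
  auxMatrix (fun k a => (Γ.dataArray lam k a).submatrix (r k) (c k)) l

/-- The set `E^k` of polynomials in `w`, for the degree bound `d`: the determinants of the square
sub-matrices of `Δ^k - w Δ^0` that are nonzero and of degree at most `d`. -/
def charPolys (lam : ℝ) (k : Fin n) (d : ℕ) : Set ℝ[X] :=
  {P | P ∈ pencilMinors (Γ.delta lam k.succ) (Γ.delta lam 0) ∧ P ≠ 0 ∧ P.natDegree ≤ d}

/-- The determinants of the square sub-matrices of `Δ^k - w Δ^0` as polynomials in both the
discount factor and `w`: elements of `ℝ[lam][w]`. -/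
def bivariateMinors (k : Fin n) : Set ℝ[X][X] :=
  pencilMinors (Γ.delta (X : ℝ[X]) k.succ) (Γ.delta (X : ℝ[X]) 0)

end Game

end Games

end StochGame

end

namespace StochGame

/-! ### Values of matrix games -/

section MatrixGames

variable {I J : Type*} [Fintype I] [Fintype J]

/-! By Shapley's theorem the vector `v` of discounted values satisfies `v k = val (G^k(lam, v))`. A
Shapley–Snow kernel turns this into linear equations: its mixed actions `x k`, `y k` equalise the
kernel at the level `v k`. Since `G^k(lam, v) - v k` is `M^k_0 + ∑ l, v l * M^k_l`, averaging the
reduced array by the `x k` against any pure profile `t` of the opponent gives an `n × (n + 1)`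
matrix that kills `(1, v)`.

Cramer's rule makes the signed maximal minors of that matrix proportional to `(1, v)`. By
multilinearity of the determinant these minors are the coordinates of `x' Δ^l`, where `x'` is the
product of the `x k` (`sum_prod_mul_auxMatrix`). So `x' Δ^k = v k • x' Δ^0`, and symmetrically `Δ^k
y' = v k • Δ^0 y'`, for the reduced matrices. Each coordinate of `x' Δ^0` is `det ((1 - lam) P - 1)`
with `P` stochastic, hence has the strict sign `(-1) ^ n`; the same holds for `Δ^0 y'`.

Everything follows from these facts about the pencil `Δ^k - w Δ^0`. (i) `x'` and `y'` multiply it to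
`(v k - w)` times vectors of one strict sign, so its value vanishes only at `w = v k`. (ii) At `w =
v k` they are null vectors paired nontrivially by `Δ^0`, so bordering a maximal nonsingular minor by
them raises the rank at some other `w` (`exists_rank_lt_rank_add_smul`). (iii) A nonzero minor of
maximal rank size is a nonzero polynomial that must vanish at `v k`, and its degree is at most `rank
Δ^0`. Reduced minors are minors of the full pencil. (iv) With rational data the same minor has
rational coefficients. -/

theorem mixedPayoff_eq_sum_row (M : Matrix I J ℝ) (x : I → ℝ) (y : J → ℝ) :
    mixedPayoff M x y = ∑ i, x i * ∑ j, M i j * y j := by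
  simp only [mixedPayoff, Finset.mul_sum, mul_assoc]

theorem mixedPayoff_eq_sum_col (M : Matrix I J ℝ) (x : I → ℝ) (y : J → ℝ) :
    mixedPayoff M x y = ∑ j, (∑ i, x i * M i j) * y j := by
  rw [mixedPayoff, Finset.sum_comm]
  simp only [Finset.sum_mul]

theorem mixedPayoff_mono {M N : Matrix I J ℝ} {x : I → ℝ} {y : J → ℝ}
    (hx : x ∈ stdSimplex ℝ I) (hy : y ∈ stdSimplex ℝ J) (h : ∀ i j, M i j ≤ N i j) :
    mixedPayoff M x y ≤ mixedPayoff N x y :=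
  Finset.sum_le_sum fun i _ => Finset.sum_le_sum fun j _ =>
    mul_le_mul_of_nonneg_right (mul_le_mul_of_nonneg_left (h i j) (hx.1 i)) (hy.1 j)

theorem mixedPayoff_add_const (M : Matrix I J ℝ) {x : I → ℝ} {y : J → ℝ}
    (hx : x ∈ stdSimplex ℝ I) (hy : y ∈ stdSimplex ℝ J) (b : ℝ) :
    mixedPayoff (fun i j => M i j + b) x y = mixedPayoff M x y + b := by
  have : ∑ i, ∑ j, x i * b * y j = b := by
    simp only [← Finset.mul_sum, hy.2, ← Finset.sum_mul, hx.2]; ring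
  simp only [mixedPayoff, mul_add, add_mul, Finset.sum_add_distrib, this]

theorem mixedPayoff_const {x : I → ℝ} {y : J → ℝ}
    (hx : x ∈ stdSimplex ℝ I) (hy : y ∈ stdSimplex ℝ J) (b : ℝ) :
    mixedPayoff (fun _ _ => b) x y = b := by
  simp only [mixedPayoff, ← Finset.mul_sum, hy.2, ← Finset.sum_mul, hx.2]; ring

theorem exists_abs_entry_le (M : Matrix I J ℝ) : ∃ b, ∀ i j, |M i j| ≤ b := by
  refine ⟨∑ i, ∑ j, |M i j|, fun i j => ?_⟩
  calc |M i j| ≤ ∑ j, |M i j| :=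
        Finset.single_le_sum (f := fun j => |M i j|) (fun _ _ => abs_nonneg _) (Finset.mem_univ j)
    _ ≤ _ := Finset.single_le_sum (f := fun i => ∑ j, |M i j|)
        (fun _ _ => Finset.sum_nonneg fun _ _ => abs_nonneg _) (Finset.mem_univ i)

theorem abs_mixedPayoff_le {M : Matrix I J ℝ} {b : ℝ} (h : ∀ i j, |M i j| ≤ b) {x : I → ℝ}
    {y : J → ℝ} (hx : x ∈ stdSimplex ℝ I) (hy : y ∈ stdSimplex ℝ J) :
    |mixedPayoff M x y| ≤ b := by
  rw [abs_le]
  constructor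
  · rw [← mixedPayoff_const hx hy (-b)]
    exact mixedPayoff_mono hx hy fun i j => (abs_le.1 (h i j)).1
  · rw [← mixedPayoff_const hx hy b]
    exact mixedPayoff_mono hx hy fun i j => (abs_le.1 (h i j)).2

theorem le_matVal [Nonempty J] {M : Matrix I J ℝ} {x : I → ℝ} (hx : x ∈ stdSimplex ℝ I) {a : ℝ}
    (h : ∀ y ∈ stdSimplex ℝ J, a ≤ mixedPayoff M x y) : a ≤ matVal M := by
  obtain ⟨b, hb⟩ := exists_abs_entry_le M
  have hne : Nonempty (stdSimplex ℝ J) := inferInstance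
  refine le_ciSup_of_le ⟨b, ?_⟩ ⟨x, hx⟩ (le_ciInf fun y => h y.1 y.2)
  rintro _ ⟨x', rfl⟩
  refine ciInf_le_of_le ⟨-b, ?_⟩ hne.some
    (abs_le.1 (abs_mixedPayoff_le hb x'.2 hne.some.2)).2
  rintro _ ⟨y', rfl⟩
  exact (abs_le.1 (abs_mixedPayoff_le hb x'.2 y'.2)).1

theorem matVal_le [Nonempty I] {M : Matrix I J ℝ} {y : J → ℝ} (hy : y ∈ stdSimplex ℝ J) {a : ℝ}
    (h : ∀ x ∈ stdSimplex ℝ I, mixedPayoff M x y ≤ a) : matVal M ≤ a := by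
  obtain ⟨b, hb⟩ := exists_abs_entry_le M
  refine ciSup_le fun x' => ciInf_le_of_le ⟨-b, ?_⟩ ⟨y, hy⟩ (h x'.1 x'.2)
  rintro _ ⟨y', rfl⟩
  exact (abs_le.1 (abs_mixedPayoff_le hb x'.2 y'.2)).1

theorem matVal_pos [Nonempty J] {M : Matrix I J ℝ} {x : I → ℝ} (hx : x ∈ stdSimplex ℝ I)
    (h : ∀ j, 0 < ∑ i, x i * M i j) : 0 < matVal M := by
  obtain ⟨j₀, hj₀⟩ := Finite.exists_min fun j => ∑ i, x i * M i j
  refine (h j₀).trans_le (le_matVal hx fun y hy => ?_)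
  rw [mixedPayoff_eq_sum_col]
  calc ∑ i, x i * M i j₀ = ∑ j, (∑ i, x i * M i j₀) * y j := by rw [← Finset.mul_sum, hy.2, mul_one]
    _ ≤ _ := Finset.sum_le_sum fun j _ => mul_le_mul_of_nonneg_right (hj₀ j) (hy.1 j)

theorem matVal_neg [Nonempty I] {M : Matrix I J ℝ} {y : J → ℝ} (hy : y ∈ stdSimplex ℝ J)
    (h : ∀ i, ∑ j, M i j * y j < 0) : matVal M < 0 := by
  obtain ⟨i₀, hi₀⟩ := Finite.exists_max fun i => ∑ j, M i j * y j
  refine (matVal_le hy fun x hx => ?_).trans_lt (h i₀)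
  rw [mixedPayoff_eq_sum_row]
  calc _ ≤ ∑ i, x i * ∑ j, M i₀ j * y j :=
        Finset.sum_le_sum fun i _ => mul_le_mul_of_nonneg_left (hi₀ i) (hx.1 i)
    _ = _ := by rw [← Finset.sum_mul, hx.2, one_mul]

variable [Nonempty I] [Nonempty J]

/-- The minimax theorem for matrix games. -/
theorem exists_optimal (M : Matrix I J ℝ) :
    ∃ x ∈ stdSimplex ℝ I, ∃ y ∈ stdSimplex ℝ J,
      (∀ y' ∈ stdSimplex ℝ J, matVal M ≤ mixedPayoff M x y') ∧
      ∀ x' ∈ stdSimplex ℝ I, mixedPayoff M x' y ≤ matVal M := by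
  have hI : (stdSimplex ℝ I).Nonempty := Set.nonempty_coe_sort.1 inferInstance
  have hJ : (stdSimplex ℝ J).Nonempty := Set.nonempty_coe_sort.1 inferInstance
  have hcx (x : I → ℝ) : Continuous fun y : J → ℝ => mixedPayoff M x y := by
    unfold mixedPayoff; fun_prop
  have hcy (y : J → ℝ) : Continuous fun x : I → ℝ => mixedPayoff M x y := by
    unfold mixedPayoff; fun_prop
  have hlx (x : I → ℝ) : IsLinearMap ℝ fun y : J → ℝ => mixedPayoff M x y := by
    constructor <;> intros <;>
      simp [mixedPayoff, mul_add, Finset.sum_add_distrib, Finset.mul_sum, mul_left_comm]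
  have hly (y : J → ℝ) : IsLinearMap ℝ fun x : I → ℝ => mixedPayoff M x y := by
    constructor <;> intros <;>
      simp [mixedPayoff, add_mul, Finset.sum_add_distrib, Finset.mul_sum, mul_assoc]
  -- Sion's theorem takes the minimising variable first, so `y` precedes `x`.
  obtain ⟨y, hy, x, hx, hsad⟩ := Sion.exists_isSaddlePointOn (f := fun y x => mixedPayoff M x y)
    hJ (convex_stdSimplex ℝ J) (isCompact_stdSimplex ℝ J)
    (fun x _ => (hcx x).continuousOn.lowerSemicontinuousOn)
    (fun x _ => ((hlx x).mk' _).convexOn (convex_stdSimplex ℝ J) |>.quasiconvexOn)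
    (convex_stdSimplex ℝ I) hI (isCompact_stdSimplex ℝ I)
    (fun y _ => (hcy y).continuousOn.upperSemicontinuousOn)
    (fun y _ => ((hly y).mk' _).concaveOn (convex_stdSimplex ℝ I) |>.quasiconcaveOn)
  have hval : matVal M = mixedPayoff M x y :=
    le_antisymm (matVal_le hy fun x' hx' => hsad y hy x' hx')
      (le_matVal hx fun y' hy' => hsad y' hy' x hx)
  exact ⟨x, hx, y, hy, fun y' hy' => hval ▸ hsad y' hy' x hx,
    fun x' hx' => hval ▸ hsad y hy x' hx'⟩

theorem matVal_le_add {M N : Matrix I J ℝ} {δ : ℝ} (h : ∀ i j, M i j ≤ N i j + δ) :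
    matVal M ≤ matVal N + δ := by
  obtain ⟨-, -, y, hy, -, hopt⟩ := exists_optimal N
  refine matVal_le hy fun x hx => ?_
  calc mixedPayoff M x y ≤ mixedPayoff (fun i j => N i j + δ) x y := mixedPayoff_mono hx hy h
    _ = mixedPayoff N x y + δ := mixedPayoff_add_const N hx hy δ
    _ ≤ _ := by linarith [hopt x hx]

theorem matVal_eq_zero {M : Matrix I J ℝ} {x : I → ℝ} {y : J → ℝ} (hx : x ∈ stdSimplex ℝ I)
    (hy : y ∈ stdSimplex ℝ J) (hxM : ∀ j, ∑ i, x i * M i j = 0) (hMy : ∀ i, ∑ j, M i j * y j = 0) :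
    matVal M = 0 := by
  apply le_antisymm
  · exact matVal_le hy fun x' _ => by simp [mixedPayoff_eq_sum_row, hMy]
  · exact le_matVal hx fun y' _ => by simp [mixedPayoff_eq_sum_col, hxM]

end MatrixGames

/-! ### Shapley's theorem -/

namespace Game

variable {n : ℕ} {I J : Fin n → Type*} (Γ : Game n I J)

/-- This one-sided estimate, used in both directions, makes the Shapley operator a `(1 -
lam)`-contraction in the sup norm. -/
theorem localGame_le_add {lam : ℝ} (hlam : lam ∈ Set.Ioc (0 : ℝ) 1) (z z' : Fin n → ℝ)
    (k : Fin n) (i : I k) (j : J k) :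
    Γ.localGame lam z k i j ≤ Γ.localGame lam z' k i j + (1 - lam) * dist z z' := by
  have h : ∑ l, (Γ.q k i j).1 l * z l ≤ ∑ l, (Γ.q k i j).1 l * (z' l + dist z z') :=
    Finset.sum_le_sum fun l _ => mul_le_mul_of_nonneg_left (by
      have := (le_abs_self _).trans (dist_le_pi_dist z z' l)
      linarith) ((Γ.q k i j).2.1 l)
  simp only [mul_add, Finset.sum_add_distrib] at h
  rw [← Finset.sum_mul, (Γ.q k i j).2.2, one_mul] at h
  have := mul_le_mul_of_nonneg_left h (sub_nonneg.2 hlam.2)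
  simp only [localGame, Matrix.of_apply]
  linarith

variable [∀ k, Fintype (I k)] [∀ k, Fintype (J k)]

theorem exists_abs_payoff_le : ∃ b, ∀ k i j, |Γ.g k i j| ≤ b := by
  choose b hb using fun k => exists_abs_entry_le (Γ.g k)
  exact ⟨∑ k, |b k|, fun k i j => ((hb k i j).trans (le_abs_self _)).trans
    (Finset.single_le_sum (f := fun k => |b k|) (fun _ _ => abs_nonneg _) (Finset.mem_univ k))⟩

theorem stagePayoff_zero (σ : Strategy I J I) (τ : Strategy I J J) (h : List (Move I J))
    (k : Fin n) :
    Γ.stagePayoff σ τ 0 h k = mixedPayoff (Γ.g k) (σ h k).1 (τ h k).1 := by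
  simp only [stagePayoff, mixedPayoff, mul_right_comm]

theorem stagePayoff_succ (σ : Strategy I J I) (τ : Strategy I J J) (t : ℕ)
    (h : List (Move I J)) (k : Fin n) :
    Γ.stagePayoff σ τ (t + 1) h k = mixedPayoff
      (fun i j => ∑ l, (Γ.q k i j).1 l * Γ.stagePayoff σ τ t (h ++ [⟨k, i, j⟩]) l)
      (σ h k).1 (τ h k).1 := by
  simp only [stagePayoff, mixedPayoff, mul_right_comm]

theorem abs_stagePayoff_le {b : ℝ} (hb : ∀ k i j, |Γ.g k i j| ≤ b) (σ : Strategy I J I)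
    (τ : Strategy I J J) (t : ℕ) (h : List (Move I J)) (k : Fin n) :
    |Γ.stagePayoff σ τ t h k| ≤ b := by
  induction t generalizing h k with
  | zero =>
    rw [stagePayoff_zero]
    exact abs_mixedPayoff_le (hb k) (σ h k).2 (τ h k).2
  | succ t ih =>
    rw [stagePayoff_succ]
    refine abs_mixedPayoff_le (fun i j => ?_) (σ h k).2 (τ h k).2
    calc _ ≤ ∑ l, |(Γ.q k i j).1 l * Γ.stagePayoff σ τ t (h ++ [⟨k, i, j⟩]) l| :=
          Finset.abs_sum_le_sum_abs _ _
      _ ≤ ∑ l, (Γ.q k i j).1 l * b := Finset.sum_le_sum fun l _ => by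
          rw [abs_mul, abs_of_nonneg ((Γ.q k i j).2.1 l)]
          exact mul_le_mul_of_nonneg_left (ih _ _) ((Γ.q k i j).2.1 l)
      _ = b := by rw [← Finset.sum_mul, (Γ.q k i j).2.2, one_mul]

theorem hasSum_payoff {lam : ℝ} (hlam : lam ∈ Set.Ioc (0 : ℝ) 1) (k : Fin n)
    (σ : Strategy I J I) (τ : Strategy I J J) :
    HasSum (fun t : ℕ => lam * (1 - lam) ^ t * Γ.stagePayoff σ τ t [] k)
      (Γ.payoff lam k σ τ) := by
  obtain ⟨b, hb⟩ := Γ.exists_abs_payoff_le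
  refine Summable.hasSum (Summable.of_norm_bounded (g := fun t => lam * (1 - lam) ^ t * b)
    (((summable_geometric_of_lt_one (by linarith [hlam.2]) (by linarith [hlam.1])).mul_left
      lam).mul_right b) fun t => ?_)
  have h1 : 0 ≤ lam * (1 - lam) ^ t :=
    mul_nonneg hlam.1.le (pow_nonneg (by linarith [hlam.2]) t)
  rw [Real.norm_eq_abs, abs_mul, abs_of_nonneg h1]
  exact mul_le_mul_of_nonneg_left (Γ.abs_stagePayoff_le hb σ τ t [] k) h1

/-- Splitting off the first stage of the truncated discounted payoff. -/
theorem sum_stagePayoff_succ (lam : ℝ) (σ : Strategy I J I) (τ : Strategy I J J) (T : ℕ)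
    (h : List (Move I J)) (k : Fin n) :
    ∑ t ∈ Finset.range (T + 1), lam * (1 - lam) ^ t * Γ.stagePayoff σ τ t h k =
      mixedPayoff (fun i j => lam * Γ.g k i j + (1 - lam) * ∑ l, (Γ.q k i j).1 l *
        ∑ t ∈ Finset.range T, lam * (1 - lam) ^ t *
          Γ.stagePayoff σ τ t (h ++ [⟨k, i, j⟩]) l) (σ h k).1 (τ h k).1 := by
  rw [Finset.sum_range_succ']
  simp only [stagePayoff_zero, stagePayoff_succ, mixedPayoff, Finset.mul_sum, mul_add, add_mul,
    Finset.sum_add_distrib, Finset.sum_mul]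
  rw [add_comm]
  congr 1
  · refine Finset.sum_congr rfl fun i _ => Finset.sum_congr rfl fun j _ => by ring
  · rw [Finset.sum_comm]
    refine Finset.sum_congr rfl fun i _ => ?_
    rw [Finset.sum_comm]
    refine Finset.sum_congr rfl fun j _ => ?_
    rw [Finset.sum_comm]
    refine Finset.sum_congr rfl fun l _ => Finset.sum_congr rfl fun t _ => by ring

/-- Dynamic programming: each stage split off costs nothing by `hz`, and the continuation missing
after `T` stages is worth at most `(1 - lam) ^ T * b`. The induction ranges over all histories
because splitting off a stage appends a move; `b` bounds `z` so that the empty sum `T = 0` is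
covered. -/
theorem le_sum_stagePayoff {lam : ℝ} (hlam : lam ∈ Set.Ioc (0 : ℝ) 1) {z : Fin n → ℝ} {b : ℝ}
    (hb : ∀ l, z l ≤ b) {σ : Strategy I J I} {τ : Strategy I J J}
    (hz : ∀ h k, z k ≤ mixedPayoff (Γ.localGame lam z k) (σ h k).1 (τ h k).1) (T : ℕ)
    (h : List (Move I J)) (k : Fin n) :
    z k - (1 - lam) ^ T * b ≤
      ∑ t ∈ Finset.range T, lam * (1 - lam) ^ t * Γ.stagePayoff σ τ t h k := by
  induction T generalizing h k with
  | zero => simpa using hb k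
  | succ T ih =>
    have hmono := mixedPayoff_mono (σ h k).2 (τ h k).2
      (M := fun i j => Γ.localGame lam z k i j + -((1 - lam) ^ (T + 1) * b))
      (N := fun i j => lam * Γ.g k i j + (1 - lam) * ∑ l, (Γ.q k i j).1 l *
        ∑ t ∈ Finset.range T, lam * (1 - lam) ^ t * Γ.stagePayoff σ τ t (h ++ [⟨k, i, j⟩]) l)
      fun i j => by
        have h1 : ∑ l, (Γ.q k i j).1 l * (z l - (1 - lam) ^ T * b) ≤ ∑ l, (Γ.q k i j).1 l *
            ∑ t ∈ Finset.range T, lam * (1 - lam) ^ t *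
              Γ.stagePayoff σ τ t (h ++ [⟨k, i, j⟩]) l :=
          Finset.sum_le_sum fun l _ => mul_le_mul_of_nonneg_left (ih _ l) ((Γ.q k i j).2.1 l)
        simp only [mul_sub, Finset.sum_sub_distrib] at h1
        rw [← Finset.sum_mul, (Γ.q k i j).2.2, one_mul] at h1
        have h2 := mul_le_mul_of_nonneg_left h1 (sub_nonneg.2 hlam.2)
        simp only [localGame, Matrix.of_apply]
        rw [pow_succ]
        linarith
    rw [mixedPayoff_add_const _ (σ h k).2 (τ h k).2] at hmono
    rw [sum_stagePayoff_succ]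
    linarith [hz h k]

theorem sum_stagePayoff_le {lam : ℝ} (hlam : lam ∈ Set.Ioc (0 : ℝ) 1) {z : Fin n → ℝ} {b : ℝ}
    (hb : ∀ l, b ≤ z l) {σ : Strategy I J I} {τ : Strategy I J J}
    (hz : ∀ h k, mixedPayoff (Γ.localGame lam z k) (σ h k).1 (τ h k).1 ≤ z k) (T : ℕ)
    (h : List (Move I J)) (k : Fin n) :
    ∑ t ∈ Finset.range T, lam * (1 - lam) ^ t * Γ.stagePayoff σ τ t h k ≤
      z k - (1 - lam) ^ T * b := by
  induction T generalizing h k with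
  | zero => simpa using hb k
  | succ T ih =>
    have hmono := mixedPayoff_mono (σ h k).2 (τ h k).2
      (N := fun i j => Γ.localGame lam z k i j + -((1 - lam) ^ (T + 1) * b))
      (M := fun i j => lam * Γ.g k i j + (1 - lam) * ∑ l, (Γ.q k i j).1 l *
        ∑ t ∈ Finset.range T, lam * (1 - lam) ^ t * Γ.stagePayoff σ τ t (h ++ [⟨k, i, j⟩]) l)
      fun i j => by
        have h1 : ∑ l, (Γ.q k i j).1 l * ∑ t ∈ Finset.range T, lam * (1 - lam) ^ t *
              Γ.stagePayoff σ τ t (h ++ [⟨k, i, j⟩]) l ≤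
            ∑ l, (Γ.q k i j).1 l * (z l - (1 - lam) ^ T * b) :=
          Finset.sum_le_sum fun l _ => mul_le_mul_of_nonneg_left (ih _ l) ((Γ.q k i j).2.1 l)
        simp only [mul_sub, Finset.sum_sub_distrib] at h1
        rw [← Finset.sum_mul, (Γ.q k i j).2.2, one_mul] at h1
        have h2 := mul_le_mul_of_nonneg_left h1 (sub_nonneg.2 hlam.2)
        simp only [localGame, Matrix.of_apply]
        rw [pow_succ]
        linarith
    rw [mixedPayoff_add_const _ (σ h k).2 (τ h k).2] at hmono
    rw [sum_stagePayoff_succ]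
    linarith [hz h k]

theorem tendsto_sub_pow_mul {lam : ℝ} (hlam : lam ∈ Set.Ioc (0 : ℝ) 1) (a b : ℝ) :
    Filter.Tendsto (fun T : ℕ => a - (1 - lam) ^ T * b) Filter.atTop (nhds a) := by
  simpa using ((tendsto_pow_atTop_nhds_zero_of_lt_one (sub_nonneg.2 hlam.2)
    (by linarith [hlam.1] : 1 - lam < 1)).mul_const b).const_sub a

theorem le_payoff {lam : ℝ} (hlam : lam ∈ Set.Ioc (0 : ℝ) 1) {z : Fin n → ℝ}
    {σ : Strategy I J I} {τ : Strategy I J J}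
    (hz : ∀ h k, z k ≤ mixedPayoff (Γ.localGame lam z k) (σ h k).1 (τ h k).1) (k : Fin n) :
    z k ≤ Γ.payoff lam k σ τ := by
  obtain ⟨b, hb⟩ := (Set.finite_range z).bddAbove
  exact le_of_tendsto_of_tendsto' (tendsto_sub_pow_mul hlam _ b)
    (Γ.hasSum_payoff hlam k σ τ).tendsto_sum_nat
    fun T => Γ.le_sum_stagePayoff hlam (fun l => hb ⟨l, rfl⟩) hz T [] k

theorem payoff_le {lam : ℝ} (hlam : lam ∈ Set.Ioc (0 : ℝ) 1) {z : Fin n → ℝ}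
    {σ : Strategy I J I} {τ : Strategy I J J}
    (hz : ∀ h k, mixedPayoff (Γ.localGame lam z k) (σ h k).1 (τ h k).1 ≤ z k) (k : Fin n) :
    Γ.payoff lam k σ τ ≤ z k := by
  obtain ⟨b, hb⟩ := (Set.finite_range z).bddBelow
  exact le_of_tendsto_of_tendsto' (Γ.hasSum_payoff hlam k σ τ).tendsto_sum_nat
    (tendsto_sub_pow_mul hlam _ b)
    fun T => Γ.sum_stagePayoff_le hlam (fun l => hb ⟨l, rfl⟩) hz T [] k

/-- The constant vectors `-b` and `b` are a sub- and a supersolution of the one-stage inequalities.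
The bound makes the real suprema and infima in `value` meaningful. -/
theorem abs_payoff_le {lam : ℝ} (hlam : lam ∈ Set.Ioc (0 : ℝ) 1) {b : ℝ}
    (hb : ∀ k i j, |Γ.g k i j| ≤ b) (σ : Strategy I J I) (τ : Strategy I J J) (k : Fin n) :
    |Γ.payoff lam k σ τ| ≤ b := by
  have hlocal (b : ℝ) (k i j) :
      Γ.localGame lam (fun _ => b) k i j = lam * Γ.g k i j + (1 - lam) * b := by
    simp only [localGame, Matrix.of_apply, ← Finset.sum_mul, (Γ.q k i j).2.2, one_mul]
  rw [abs_le]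
  constructor
  · refine Γ.le_payoff hlam (z := fun _ => -b) (fun h k => ?_) k
    refine (mixedPayoff_const (σ h k).2 (τ h k).2 (-b)).symm.trans_le
      (mixedPayoff_mono (σ h k).2 (τ h k).2 fun i j => ?_)
    rw [hlocal]
    nlinarith [(abs_le.1 (hb k i j)).1, hlam.1]
  · refine Γ.payoff_le hlam (z := fun _ => b) (fun h k => ?_) k
    refine (mixedPayoff_mono (σ h k).2 (τ h k).2 fun i j => ?_).trans_eq
      (mixedPayoff_const (σ h k).2 (τ h k).2 b)
    rw [hlocal]
    nlinarith [(abs_le.1 (hb k i j)).2, hlam.1]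

variable [∀ k, Nonempty (I k)] [∀ k, Nonempty (J k)]

/-- Playing optimally in the local game after every history guarantees `z` to either player, against
every history-dependent strategy of the opponent. -/
theorem value_eq_of_fixedPoint {lam : ℝ} (hlam : lam ∈ Set.Ioc (0 : ℝ) 1) {z : Fin n → ℝ}
    (hz : ∀ k, matVal (Γ.localGame lam z k) = z k) (k : Fin n) : Γ.value lam k = z k := by
  choose x hx y hy hxopt hyopt using fun k => exists_optimal (Γ.localGame lam z k)
  obtain ⟨b, hb⟩ := Γ.exists_abs_payoff_le
  have hbelow (σ : Strategy I J I) :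
      BddBelow (Set.range fun τ : Strategy I J J => Γ.payoff lam k σ τ) := by
    refine ⟨-b, ?_⟩
    rintro _ ⟨τ, rfl⟩
    exact (abs_le.1 (Γ.abs_payoff_le hlam hb σ τ k)).1
  let τ₀ : Strategy I J J := fun _ k => ⟨y k, hy k⟩
  let σ₀ : Strategy I J I := fun _ k => ⟨x k, hx k⟩
  have : Nonempty (Strategy I J I) := ⟨σ₀⟩
  have : Nonempty (Strategy I J J) := ⟨τ₀⟩
  have hle (σ : Strategy I J I) : Γ.payoff lam k σ τ₀ ≤ z k :=
    Γ.payoff_le hlam (z := z) (σ := σ) (τ := τ₀)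
      (fun h l => (hyopt l _ (σ h l).2).trans_eq (hz l)) k
  have hge (τ : Strategy I J J) : z k ≤ Γ.payoff lam k σ₀ τ :=
    Γ.le_payoff hlam (z := z) (σ := σ₀) (τ := τ)
      (fun h l => (hz l).symm.trans_le (hxopt l _ (τ h l).2)) k
  apply le_antisymm
  · exact ciSup_le fun σ => ciInf_le_of_le (hbelow σ) τ₀ (hle σ)
  · refine le_ciSup_of_le ⟨b, ?_⟩ σ₀ (le_ciInf hge)
    rintro _ ⟨σ, rfl⟩
    exact ciInf_le_of_le (hbelow σ) τ₀ (abs_le.1 (Γ.abs_payoff_le hlam hb σ τ₀ k)).2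

/-- The values of the discounted game solve Shapley's equation. -/
theorem matVal_localGame_value {lam : ℝ} (hlam : lam ∈ Set.Ioc (0 : ℝ) 1) (k : Fin n) :
    matVal (Γ.localGame lam (fun l => Γ.value lam l) k) = Γ.value lam k := by
  obtain ⟨K, hK⟩ : ∃ K : NNReal, (K : ℝ) = 1 - lam := ⟨⟨1 - lam, sub_nonneg.2 hlam.2⟩, rfl⟩
  have hcon : ContractingWith K
      (fun (z : Fin n → ℝ) k => matVal (Γ.localGame lam z k)) := by
    refine ⟨?_, LipschitzWith.of_dist_le_mul fun z z' => ?_⟩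
    · rw [← NNReal.coe_lt_coe, hK, NNReal.coe_one]
      linarith [hlam.1]
    · refine (dist_pi_le_iff (by positivity)).2 fun k => ?_
      rw [Real.dist_eq, abs_le]
      have h1 := matVal_le_add (Γ.localGame_le_add hlam z z' k)
      have h2 := matVal_le_add (Γ.localGame_le_add hlam z' z k)
      rw [dist_comm z'] at h2
      rw [hK]
      constructor <;> linarith
  -- Banach's theorem supplies a fixed point, and any fixed point is the value vector.
  obtain ⟨z, hz⟩ : ∃ z : Fin n → ℝ, ∀ k, matVal (Γ.localGame lam z k) = z k :=
    ⟨_, fun k => congrFun hcon.fixedPoint_isFixedPt k⟩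
  have : (fun l => Γ.value lam l) = z := funext (Γ.value_eq_of_fixedPoint hlam hz)
  rw [this, Γ.value_eq_of_fixedPoint hlam hz, hz]

end Game

/-! ### Ranks and determinants -/

section LinearAlgebra

variable {ι κ K : Type*} [Field K]

/-- A matrix of rank `ρ` has `ρ` linearly independent rows. -/
theorem exists_submatrix_row_linearIndependent [Fintype ι] [Fintype κ] (A : Matrix ι κ K) {ρ : ℕ}
    (hρ : A.rank = ρ) : ∃ r : Fin ρ ↪ ι, LinearIndependent K (A.submatrix r id).row := by
  obtain ⟨f, hf, -, hli⟩ := Submodule.exists_fun_fin_finrank_span_eq K (Set.range A.row)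
  rw [A.rank_eq_finrank_span_row] at hρ
  subst hρ
  choose r hr using hf
  have hrf : (A.submatrix r id).row = f := funext hr
  exact ⟨⟨r, fun a b h => hli.injective (by rw [← hr, ← hr, h])⟩, hrf ▸ hli⟩

/-- A matrix has a nonsingular square sub-matrix of size its rank. -/
theorem exists_submatrix_det_ne_zero [Fintype ι] [Fintype κ] (A : Matrix ι κ K) {ρ : ℕ}
    (hρ : A.rank = ρ) :
    ∃ (r : Fin ρ ↪ ι) (c : Fin ρ ↪ κ), (A.submatrix r c).det ≠ 0 := by
  obtain ⟨r, hr⟩ := exists_submatrix_row_linearIndependent A hρ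
  have hrank : ((A.submatrix r id).transpose).rank = ρ := by
    rw [Matrix.rank_transpose, hr.rank_matrix, Fintype.card_fin]
  obtain ⟨c, hc⟩ := exists_submatrix_row_linearIndependent _ hrank
  refine ⟨r, c, ?_⟩
  have := (Matrix.isUnit_iff_isUnit_det _).1 (Matrix.linearIndependent_rows_iff_isUnit.1 hc)
  rw [← Matrix.det_transpose]
  exact this.ne_zero

/-- The degree of `det (A - X B)` is at most the rank of `B`. -/
theorem natDegree_det_pencil_le {m : ℕ} (A B : Matrix (Fin m) (Fin m) K) :
    (Matrix.det (Matrix.of fun a b => C (A a b) - X * C (B a b))).natDegree ≤ B.rank := by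
  classical
  -- Equivalence only scales the determinant by a nonzero constant, and in rank normal form `X`
  -- occurs only in the first `B.rank` rows.
  obtain ⟨V, U, e, hV, hU, hVU⟩ := B.exists_rank_normal_form
  set M : Matrix (Fin m) (Fin m) K[X] := Matrix.of fun a b => C (A a b) - X * C (B a b) with hM
  have hconj : V.map C * M * U.map C =
      (V * A * U).map C - (X : K[X]) • (V * B * U).map C := by
    have : M = A.map C - (X : K[X]) • B.map C := by
      ext a b : 2
      simp [hM]
    rw [this, Matrix.map_mul, Matrix.map_mul, Matrix.map_mul, Matrix.map_mul, Matrix.mul_sub,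
      Matrix.sub_mul, Matrix.mul_smul, Matrix.smul_mul]
  have hdet : (V.map C * M * U.map C).det = C (V.det * U.det) * M.det := by
    have hmap (W : Matrix (Fin m) (Fin m) K) : (W.map C).det = C W.det :=
      ((C : K →+* K[X]).map_det W).symm
    rw [Matrix.det_mul, Matrix.det_mul, hmap, hmap, map_mul]
    ring
  have hne : V.det * U.det ≠ 0 :=
    mul_ne_zero ((Matrix.isUnit_iff_isUnit_det _).1 hV).ne_zero
      ((Matrix.isUnit_iff_isUnit_det _).1 hU).ne_zero
  rw [← natDegree_C_mul hne, ← hdet, hconj, Matrix.det_apply]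
  refine natDegree_sum_le_of_forall_le _ _ fun σ _ => ?_
  refine (natDegree_smul_le _ _).trans ((natDegree_prod_le _ _).trans ?_)
  -- Reindexed so that the factors of a Leibniz term are counted by row.
  rw [← Equiv.sum_comp σ⁻¹]
  calc _ ≤ ∑ a, (Sum.elim (fun _ => 1) (fun _ => 0) (e a) : ℕ) := by
        refine Finset.sum_le_sum fun a _ => ?_
        rw [hVU]
        generalize V * A * U = A'
        change (C (A' _ _) - X * C (Matrix.fromBlocks 1 0 0 0 (e _) (e _)) : K[X]).natDegree ≤ _
        rw [show σ (σ⁻¹ a) = a from σ.apply_symm_apply a]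
        rcases h : e a with b | b
        · refine (natDegree_sub_le _ _).trans (max_le (by simp) ?_)
          exact natDegree_mul_le.trans (by simp)
        · rcases e (σ⁻¹ a) with b' | b' <;> simp
    _ = B.rank := by
        rw [e.sum_comp (fun q => (Sum.elim (fun _ => 1) (fun _ => 0) q : ℕ))]
        simp

end LinearAlgebra

/-- If the pencil `N + w B` is degenerate at `w = 0` along left and right kernel vectors that `B`
pairs nontrivially, then its rank is not maximal at `w = 0`. -/
theorem exists_rank_lt_rank_add_smul {ι κ : Type*} [Fintype ι] [Fintype κ] (N B : Matrix ι κ ℝ)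
    {x : ι → ℝ} {y : κ → ℝ} (hx : Matrix.vecMul x N = 0) (hy : N.mulVec y = 0)
    (hxy : x ⬝ᵥ B.mulVec y ≠ 0) : ∃ w : ℝ, N.rank < (N + w • B).rank := by
  obtain ⟨r, c, hdet⟩ := exists_submatrix_det_ne_zero N rfl
  let u : Matrix (Fin N.rank) Unit ℝ := .of fun a _ => B.mulVec y (r a)
  let v : Matrix Unit (Fin N.rank) ℝ := .of fun _ b => Matrix.vecMul x B (c b)
  let d : Matrix Unit Unit ℝ := .of fun _ _ => x ⬝ᵥ B.mulVec y
  -- The bordered minor with a factor `w` removed from its last row. At `w = 0` it is block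
  -- triangular, with determinant the nonzero minor of `N` times the nonzero pairing.
  let F : ℝ → ℝ := fun w => (Matrix.fromBlocks
    (N.submatrix r c + w • B.submatrix r c) (w • u) v d).det
  have hF : Continuous F := by
    refine Continuous.matrix_det (Continuous.matrix_fromBlocks ?_ ?_ ?_ ?_) <;> fun_prop
  have hF0 : F 0 ≠ 0 := by
    simp only [F, zero_smul, add_zero, Matrix.det_fromBlocks_zero₁₂]
    simpa [d] using ⟨hdet, hxy⟩
  obtain ⟨w, hw0, hw⟩ : ∃ w, w ≠ 0 ∧ F w ≠ 0 := by
    have h1 : ∀ᶠ w in nhdsWithin (0 : ℝ) {0}ᶜ, F w ≠ 0 :=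
      (hF.continuousAt.eventually_ne hF0).filter_mono nhdsWithin_le_nhds
    have h2 : ∀ᶠ w in nhdsWithin (0 : ℝ) {0}ᶜ, w ∈ ({0}ᶜ : Set ℝ) := self_mem_nhdsWithin
    exact (h2.and h1).exists
  refine ⟨w, ?_⟩
  classical
  -- `L` and `R` select the rows and columns of the minor and append `x` and `y`, so the product
  -- below has size `N.rank + 1`.
  let L : Matrix (Fin N.rank ⊕ Unit) ι ℝ := Matrix.of (Sum.elim (fun a => Pi.single (r a) 1) fun _ => x)
  let R : Matrix κ (Fin N.rank ⊕ Unit) ℝ :=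
    (Matrix.of (Sum.elim (fun b => Pi.single (c b) 1) fun _ => y)).transpose
  have hLR : L * (N + w • B) * R = Matrix.fromBlocks 1 0 0 (w • (1 : Matrix Unit Unit ℝ)) *
      Matrix.fromBlocks (N.submatrix r c + w • B.submatrix r c) (w • u) v d := by
    have hN : (N + w • B).mulVec y = w • B.mulVec y := by
      rw [Matrix.add_mulVec, hy, zero_add, Matrix.smul_mulVec]
    have hN' : Matrix.vecMul x (N + w • B) = w • Matrix.vecMul x B := by
      rw [Matrix.vecMul_add, hx, zero_add, Matrix.vecMul_smul]
    rw [Matrix.fromBlocks_multiply]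
    ext (a | a) (b | b)
    · simp [L, R, Matrix.mul_apply, Pi.single_apply]
    · trans ((N + w • B).mulVec y) (r a)
      · simp [L, R, Matrix.mul_apply, Pi.single_apply, Matrix.mulVec, dotProduct]
      · simp [hN, u]
    · trans (Matrix.vecMul x (N + w • B)) (c b)
      · simp [L, R, Matrix.mul_apply, Pi.single_apply, Matrix.vecMul, dotProduct]
      · simp [hN', v]
    · trans x ⬝ᵥ (N + w • B).mulVec y
      · rw [Matrix.mul_assoc]
        simp [L, R, Matrix.mul_apply, Matrix.mulVec, dotProduct]
      · simp [hN, d]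
  have hne : (L * (N + w • B) * R).det ≠ 0 := by
    rw [hLR, Matrix.det_mul, Matrix.det_fromBlocks_zero₁₂]
    simpa using ⟨hw0, hw⟩
  have h1 := Matrix.rank_of_det_ne_zero hne
  have h2 := (Matrix.rank_mul_le_left (L * (N + w • B)) R).trans (Matrix.rank_mul_le_right _ _)
  simp only [Fintype.card_sum, Fintype.card_fin, Fintype.card_unit] at h1
  omega

/-- The signed maximal minors of an `n × (n + 1)` matrix are proportional to the coordinates of a
kernel vector. -/
theorem det_succAbove_of_kernel {n : ℕ} (a : Matrix (Fin n) (Fin (n + 1)) ℝ) (v : Fin n → ℝ)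
    (h : ∀ k, a k 0 + ∑ l, v l * a k l.succ = 0) (l : Fin n) :
    (-1) ^ (l.succ : ℕ) * (a.submatrix id l.succ.succAbove).det =
      v l * (a.submatrix id (Fin.succAbove 0)).det := by
  -- The row `u` is orthogonal to `(1, v)`. Put on top of `a` it gives a singular square matrix,
  -- whose Laplace expansion along `u` is the claim.
  let u : Fin (n + 1) → ℝ := Pi.single l.succ 1 - v l • Pi.single 0 1
  let b : Matrix (Fin (n + 1)) (Fin (n + 1)) ℝ := Matrix.of (Fin.cons u fun k => a k)
  have hb0 (j) : b 0 j = u j := rfl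
  have hbs (k : Fin n) (j) : b k.succ j = a k j := rfl
  have hdet : b.det = 0 := by
    refine Matrix.exists_mulVec_eq_zero_iff.1 ⟨Fin.cons 1 v, fun h0 => ?_, ?_⟩
    · simpa using congrFun h0 0
    · ext k
      refine Fin.cases ?_ (fun k => ?_) k
      · simp [hb0, u, Matrix.mulVec, dotProduct, Fin.sum_univ_succ, Pi.single_apply,
          (Fin.succ_ne_zero l).symm]
      · simp only [hbs, Matrix.mulVec, dotProduct, Fin.sum_univ_succ, Fin.cons_succ,
          Fin.cons_zero, Pi.zero_apply]
        rw [← h k]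
        simp [mul_comm]
  rw [Matrix.det_succ_row_zero] at hdet
  have hsub (j : Fin (n + 1)) : b.submatrix Fin.succ j.succAbove = a.submatrix id j.succAbove :=
    rfl
  simp only [hsub] at hdet
  simp only [hb0, u, Pi.sub_apply, Pi.smul_apply, Pi.single_apply, smul_eq_mul, mul_sub, sub_mul,
    Finset.sum_sub_distrib, mul_ite, ite_mul, mul_one, mul_zero, zero_mul, Finset.sum_ite_eq',
    Finset.mem_univ, if_true] at hdet
  simpa [sub_eq_zero] using hdet

/-- Strict diagonal dominance keeps the determinant nonzero for `s` in `[0, 1)`. It equals `1` at `s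
= 0`, so it cannot change sign. -/
theorem det_one_sub_smul_pos {n : ℕ} {p : Matrix (Fin n) (Fin n) ℝ}
    (hp : ∀ k, p k ∈ stdSimplex ℝ (Fin n)) {s : ℝ} (hs : s ∈ Set.Ico (0 : ℝ) 1) :
    0 < (1 - s • p).det := by
  have hne (s : ℝ) (hs : s ∈ Set.Ico (0 : ℝ) 1) : (1 - s • p).det ≠ 0 := by
    refine det_ne_zero_of_sum_row_lt_diag fun k => ?_
    have h1 : ∑ j ∈ Finset.univ.erase k, ‖(1 - s • p) k j‖ =
        ∑ j ∈ Finset.univ.erase k, s * p k j := by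
      refine Finset.sum_congr rfl fun j hj => ?_
      have : k ≠ j := (Finset.ne_of_mem_erase hj).symm
      simp [Matrix.one_apply_ne this, abs_of_nonneg hs.1, abs_of_nonneg ((hp k).1 j)]
    have h2 : p k k + ∑ j ∈ Finset.univ.erase k, p k j = 1 := by
      rw [Finset.add_sum_erase _ _ (Finset.mem_univ k), (hp k).2]
    rw [h1, ← Finset.mul_sum, Real.norm_eq_abs]
    refine lt_of_lt_of_le ?_ (le_abs_self _)
    simp only [Matrix.sub_apply, Matrix.one_apply_eq, Matrix.smul_apply, smul_eq_mul]
    have h3 := congrArg (s * ·) h2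
    simp only [mul_add, mul_one] at h3
    linarith [hs.2]
  have hcont : Continuous fun s : ℝ => (1 - s • p).det := by fun_prop
  by_contra hle
  obtain ⟨t, ht, ht0⟩ := intermediate_value_Icc' hs.1 hcont.continuousOn
    (show (0 : ℝ) ∈ Set.Icc _ _ from ⟨not_lt.1 hle, by simp⟩)
  exact hne t ⟨ht.1, ht.2.trans_lt hs.2⟩ ht0

/-! ### Auxiliary matrices -/

section AuxMatrix

variable {R : Type*} [CommRing R] {n : ℕ} {I J : Fin n → Type*}

theorem kroneckerDet_apply (A : ∀ k, Fin n → Matrix (I k) (J k) R) (s : ∀ k, I k) (t : ∀ k, J k) :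
    kroneckerDet A s t = Matrix.det (Matrix.of fun k a => A k a (s k) (t k)) := by
  rw [← Matrix.det_transpose, Matrix.det_apply']
  simp [kroneckerDet, kroneckerProd, Matrix.sum_apply]

theorem auxMatrix_apply (D : ∀ k, Fin (n + 1) → Matrix (I k) (J k) R) (l : Fin (n + 1))
    (s : ∀ k, I k) (t : ∀ k, J k) :
    auxMatrix D l s t = (-1) ^ (l : ℕ) *
      ((Matrix.of fun k l => D k l (s k) (t k)).submatrix id l.succAbove).det := by
  rw [auxMatrix, Matrix.smul_apply, kroneckerDet_apply, smul_eq_mul]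
  rfl

theorem auxMatrix_map {S : Type*} [CommRing S] (f : R →+* S)
    (D : ∀ k, Fin (n + 1) → Matrix (I k) (J k) R) (l : Fin (n + 1)) :
    auxMatrix (fun k a => (D k a).map f) l = (auxMatrix D l).map f := by
  ext s t
  simp only [auxMatrix_apply, Matrix.map_apply, map_mul, map_pow, map_neg, map_one, f.map_det]
  rfl

theorem auxMatrix_submatrix {I' J' : Fin n → Type*}
    (D : ∀ k, Fin (n + 1) → Matrix (I k) (J k) R) (r : ∀ k, I' k → I k) (c : ∀ k, J' k → J k)
    (l : Fin (n + 1)) :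
    auxMatrix (fun k a => (D k a).submatrix (r k) (c k)) l =
      (auxMatrix D l).submatrix (fun s k => r k (s k)) (fun t k => c k (t k)) := by
  ext s t
  simp only [auxMatrix_apply, Matrix.submatrix_apply]

theorem auxMatrix_transpose (D : ∀ k, Fin (n + 1) → Matrix (I k) (J k) R) (l : Fin (n + 1)) :
    auxMatrix (fun k a => (D k a).transpose) l = (auxMatrix D l).transpose := by
  ext s t
  simp only [auxMatrix_apply, Matrix.transpose_apply]

/-- Row `k` of the determinant giving the entry depends on `s` only through `s k`, so product
weights average each row separately. -/
theorem sum_prod_mul_auxMatrix [∀ k, Fintype (I k)] (D : ∀ k, Fin (n + 1) → Matrix (I k) (J k) R)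
    (x : ∀ k, I k → R) (l : Fin (n + 1)) (t : ∀ k, J k) :
    ∑ s, (∏ k, x k (s k)) * auxMatrix D l s t = (-1) ^ (l : ℕ) *
      ((Matrix.of fun k l => ∑ i, x k i * D k l i (t k)).submatrix id l.succAbove).det := by
  have h := (Matrix.detRowAlternating (n := Fin n) (R := R)).toMultilinearMap.map_sum
    (fun k i => x k i • fun a => D k (l.succAbove a) i (t k))
  simp only [MultilinearMap.map_smul_univ] at h
  simp only [auxMatrix_apply]
  simp only [mul_left_comm _ ((-1 : R) ^ (l : ℕ)), ← Finset.mul_sum]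
  congr 1
  refine h.symm.trans ?_
  change Matrix.det _ = Matrix.det _
  congr 1
  ext k a
  simp [Finset.sum_apply]

/-- Mixed actions that solve the linear system given by an array with kernel vector `(1, v)`. -/
theorem sum_prod_mul_auxMatrix_succ [∀ k, Fintype (I k)]
    (D : ∀ k, Fin (n + 1) → Matrix (I k) (J k) ℝ) (x : ∀ k, I k → ℝ) (v : Fin n → ℝ)
    (h : ∀ k j, ∑ i, x k i * (D k 0 i j + ∑ l, v l * D k l.succ i j) = 0) (l : Fin n)
    (t : ∀ k, J k) :
    ∑ s, (∏ k, x k (s k)) * auxMatrix D l.succ s t =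
      v l * ∑ s, (∏ k, x k (s k)) * auxMatrix D 0 s t := by
  rw [sum_prod_mul_auxMatrix, sum_prod_mul_auxMatrix, det_succAbove_of_kernel _ v]
  · simp
  · intro k
    rw [← h k (t k)]
    simp only [Matrix.of_apply, mul_add, Finset.sum_add_distrib, Finset.mul_sum]
    rw [Finset.sum_comm]
    simp only [mul_left_comm]

theorem prod_mem_stdSimplex [∀ k, Fintype (I k)] {x : ∀ k, I k → ℝ}
    (hx : ∀ k, x k ∈ stdSimplex ℝ (I k)) :
    (fun s : ∀ k, I k => ∏ k, x k (s k)) ∈ stdSimplex ℝ (∀ k, I k) := by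
  refine ⟨fun s => Finset.prod_nonneg fun k _ => (hx k).1 _, ?_⟩
  rw [← Fintype.prod_sum]
  exact Finset.prod_eq_one fun k _ => (hx k).2

end AuxMatrix

/-! ### Pencils -/

theorem pencilMinors_finite {R ι κ : Type*} [CommRing R] [Finite ι] [Finite κ]
    (A B : Matrix ι κ R) : (pencilMinors A B).Finite := by
  have hsub : pencilMinors A B ⊆ ⋃ m ∈ Set.Iic (Nat.card ι), Set.range
      fun p : (Fin m ↪ ι) × (Fin m ↪ κ) => Matrix.det
        (Matrix.of fun a b => C (A (p.1 a) (p.2 b)) - X * C (B (p.1 a) (p.2 b))) := by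
    rintro P ⟨m, r, c, -, rfl⟩
    have := Nat.card_le_card_of_injective r r.injective
    rw [Nat.card_fin] at this
    exact Set.mem_biUnion this ⟨(r, c), rfl⟩
  exact ((Set.finite_Iic _).biUnion fun m _ => Set.finite_range _).subset hsub

theorem map_det_pencil {R S ι κ : Type*} [CommRing R] [CommRing S] (f : R →+* S)
    (A B : Matrix ι κ R) {m : ℕ} (r : Fin m → ι) (c : Fin m → κ) :
    (Matrix.det (Matrix.of fun a b => C (A (r a) (c b)) - X * C (B (r a) (c b)))).map f =
      Matrix.det (Matrix.of fun a b =>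
        C ((A.map f) (r a) (c b)) - X * C ((B.map f) (r a) (c b))) := by
  rw [← coe_mapRingHom, RingHom.map_det]
  congr 1
  ext a b : 2
  simp

theorem eval_det_pencil {R ι κ : Type*} [CommRing R] (A B : Matrix ι κ R) {m : ℕ}
    (r : Fin m → ι) (c : Fin m → κ) (w : R) :
    (Matrix.det (Matrix.of fun a b => C (A (r a) (c b)) - X * C (B (r a) (c b)))).eval w =
      ((A - w • B).submatrix r c).det := by
  rw [← coe_evalRingHom, RingHom.map_det]
  congr 1
  ext a b
  simp
  ring

/-! ### Shapley–Snow kernels -/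

/-- The chosen indices already carry the whole mass, so `x` vanishes elsewhere. -/
theorem sum_comp_embedding_of_mem_stdSimplex {I : Type*} [Fintype I] {m : ℕ} {r : Fin m ↪ I}
    {x : I → ℝ} (hx : x ∈ stdSimplex ℝ I) (hr : ∑ a, x (r a) = 1) (f : I → ℝ) :
    ∑ i, x i * f i = ∑ a, x (r a) * f (r a) := by
  classical
  refine (Fintype.sum_of_injective r r.injective _ _ (fun i hi => ?_) fun _ => rfl).symm
  have hi' : i ∉ Finset.univ.map r := by simpa using hi
  have h := Finset.sum_le_univ_sum_of_nonneg (s := Finset.cons i _ hi') hx.1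
  rw [Finset.sum_cons, Finset.sum_map, hr, hx.2] at h
  rw [le_antisymm (by linarith) (hx.1 i), zero_mul]

/-- The mixed actions given by a Shapley–Snow kernel are equalising in the kernel. -/
theorem IsShapleySnowKernel.exists_equalizing {I J : Type*} [Fintype I] [Fintype J]
    {G : Matrix I J ℝ} {m : ℕ} {r : Fin m ↪ I} {c : Fin m ↪ J}
    (h : IsShapleySnowKernel G r c) :
    ∃ x ∈ stdSimplex ℝ (Fin m), ∃ y ∈ stdSimplex ℝ (Fin m),
      (∀ b, ∑ a, x a * G (r a) (c b) = matVal G) ∧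
      ∀ a, ∑ b, G (r a) (c b) * y b = matVal G := by
  obtain ⟨⟨x, y⟩, hxy, hS, hx, hy⟩ := h
  obtain ⟨⟨hxs, hxopt⟩, hys, hyopt⟩ := extremePoints_subset hxy
  dsimp only at hx hy hxs hxopt hys hyopt
  set H := G.submatrix r c with hH
  set S := entrySum (cofactorMatrix H) with hSdef
  have hx1 : ∑ a, x (r a) = 1 := by
    simp only [hx, ← Finset.sum_div]
    exact div_self hS
  have hy1 : ∑ b, y (c b) = 1 := by
    simp only [hy, ← Finset.sum_div]
    rw [Finset.sum_comm]
    exact div_self hS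
  -- Summing a column of `adj H * H = det H • 1` gives the same number for every column.
  have hxH (b) : ∑ a, x (r a) * H a b = H.det / S := by
    have h1 : ∑ b', (H.adjugate * H) b' b = H.det := by
      simp [Matrix.adjugate_mul, Matrix.one_apply]
    rw [← h1]
    simp only [hx, cofactorMatrix, Matrix.transpose_apply, Matrix.mul_apply, Finset.sum_div,
      Finset.sum_mul]
    rw [Finset.sum_comm]
    exact Finset.sum_congr rfl fun _ _ => Finset.sum_congr rfl fun _ _ => by ring
  have hHy (a) : ∑ b, H a b * y (c b) = H.det / S := by
    have h1 : ∑ b', (H * H.adjugate) a b' = H.det := by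
      simp [Matrix.mul_adjugate, Matrix.one_apply]
    rw [← h1]
    simp only [hy, cofactorMatrix, Matrix.transpose_apply, Matrix.mul_apply, Finset.sum_div,
      Finset.mul_sum]
    rw [Finset.sum_comm]
    exact Finset.sum_congr rfl fun _ _ => Finset.sum_congr rfl fun _ _ => by ring
  have hval : matVal G = H.det / S := by
    rw [le_antisymm (hxopt y hys) (hyopt x hxs), mixedPayoff_eq_sum_row,
      sum_comp_embedding_of_mem_stdSimplex hxs hx1]
    have h1 (i) : ∑ j, G i j * y j = ∑ b, G i (c b) * y (c b) := by
      simp only [mul_comm (G i _)]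
      exact sum_comp_embedding_of_mem_stdSimplex hys hy1 _
    simp only [h1]
    change ∑ a, x (r a) * ∑ b, H a b * y (c b) = _
    simp only [hHy, ← Finset.sum_mul, hx1, one_mul]
  rw [hval]
  exact ⟨fun a => x (r a), ⟨fun a => hxs.1 _, hx1⟩, fun b => y (c b), ⟨fun b => hys.1 _, hy1⟩,
    hxH, hHy⟩

/-! ### Pencils with a completely mixed direction -/

section Pencil

variable {ι κ : Type*} [Fintype ι] [Fintype κ] {A B : Matrix ι κ ℝ} {x : ι → ℝ} {y : κ → ℝ}
  {v η : ℝ}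

/-- For `w ≠ v` the sign of `ε * (v - w) / η` tells which player gets a strict guarantee: `x`
secures a positive amount or `y` a negative one. At `w = v` both equalise at zero. The parameter `η`
carries the common sign of `xB` and `By`. -/
theorem matVal_smul_pencil_eq_zero_iff [Nonempty ι] [Nonempty κ] (hx : x ∈ stdSimplex ℝ ι)
    (hy : y ∈ stdSimplex ℝ κ) (hxA : ∀ t, ∑ s, x s * A s t = v * ∑ s, x s * B s t)
    (hAy : ∀ s, ∑ t, A s t * y t = v * ∑ t, B s t * y t) (hxB : ∀ t, 0 < η * ∑ s, x s * B s t)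
    (hBy : ∀ s, 0 < η * ∑ t, B s t * y t) {ε : ℝ} (hε : ε ≠ 0) (w : ℝ) :
    matVal (ε • (A - w • B)) = 0 ↔ w = v := by
  have hxw (t) : ∑ s, x s * (ε • (A - w • B)) s t = ε * (v - w) * ∑ s, x s * B s t := by
    rw [mul_assoc, sub_mul, ← hxA, Finset.mul_sum, ← Finset.sum_sub_distrib, Finset.mul_sum]
    refine Finset.sum_congr rfl fun s _ => ?_
    simp only [Matrix.smul_apply, Matrix.sub_apply, smul_eq_mul]
    ring
  have hwy (s) : ∑ t, (ε • (A - w • B)) s t * y t = ε * (v - w) * ∑ t, B s t * y t := by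
    rw [mul_assoc, sub_mul, ← hAy, Finset.mul_sum, ← Finset.sum_sub_distrib, Finset.mul_sum]
    refine Finset.sum_congr rfl fun s _ => ?_
    simp only [Matrix.smul_apply, Matrix.sub_apply, smul_eq_mul]
    ring
  have hη : η ≠ 0 := fun h => by simpa [h] using hxB (Classical.arbitrary κ)
  refine ⟨fun h => ?_, fun h => matVal_eq_zero hx hy (fun t => ?_) fun s => ?_⟩
  · by_contra hne
    have hκ : ε * (v - w) / η ≠ 0 :=
      div_ne_zero (mul_ne_zero hε (sub_ne_zero.2 (Ne.symm hne))) hη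
    rcases hκ.lt_or_gt with hneg | hpos
    · refine (matVal_neg hy fun s => ?_).ne h
      rw [hwy]
      calc _ = ε * (v - w) / η * (η * ∑ t, B s t * y t) := by field_simp
        _ < 0 := mul_neg_of_neg_of_pos hneg (hBy s)
    · refine (matVal_pos hx fun t => ?_).ne' h
      rw [hxw]
      calc 0 < ε * (v - w) / η * (η * ∑ s, x s * B s t) := mul_pos hpos (hxB t)
        _ = _ := by field_simp
  · rw [hxw, h]; ring
  · rw [hwy, h]; ring

/-- At `v` the pencil has the null vectors `x` and `y`, and `B` pairs them nontrivially because `By`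
has a strict sign and `x` has mass one. -/
theorem exists_isGreatest_rank_pencil (hx : x ∈ stdSimplex ℝ ι)
    (hxA : ∀ t, ∑ s, x s * A s t = v * ∑ s, x s * B s t)
    (hAy : ∀ s, ∑ t, A s t * y t = v * ∑ t, B s t * y t)
    (hBy : ∀ s, 0 < η * ∑ t, B s t * y t) :
    ∃ ρ : ℕ, IsGreatest (Set.range fun w : ℝ => (A - w • B).rank) ρ ∧ (A - v • B).rank < ρ := by
  obtain ⟨w, hw⟩ := exists_rank_lt_rank_add_smul (A - v • B) B (x := x) (y := y)
    (by
      rw [Matrix.vecMul_sub, Matrix.vecMul_smul, sub_eq_zero]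
      exact funext hxA)
    (by
      rw [Matrix.sub_mulVec, Matrix.smul_mulVec, sub_eq_zero]
      exact funext hAy)
    (fun h => by
      have h1 : 0 < ∑ s, x s * (η * ∑ t, B s t * y t) := by
        refine lt_of_le_of_ne
          (Finset.sum_nonneg fun s _ => mul_nonneg (hx.1 s) (hBy s).le) fun h0 => ?_
        have h2 := (Finset.sum_eq_zero_iff_of_nonneg
          fun s _ => mul_nonneg (hx.1 s) (hBy s).le).1 h0.symm
        have h3 : ∑ s, x s = 0 := Finset.sum_eq_zero fun s hs =>
          (mul_eq_zero.1 (h2 s hs)).resolve_right (hBy s).ne'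
        exact one_ne_zero (hx.2.symm.trans h3)
      have h2 : ∑ s, x s * (η * ∑ t, B s t * y t) = η * x ⬝ᵥ B.mulVec y := by
        simp only [dotProduct, Matrix.mulVec, Finset.mul_sum, mul_left_comm]
      rw [h2, h, mul_zero] at h1
      exact h1.false)
  have hbdd : BddAbove (Set.range fun w : ℝ => (A - w • B).rank) := by
    refine ⟨Fintype.card κ, ?_⟩
    rintro _ ⟨w, rfl⟩
    exact Matrix.rank_le_card_width _
  refine ⟨_, ⟨Nat.sSup_mem (Set.range_nonempty _) hbdd, fun _ h => le_csSup hbdd h⟩,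
    hw.trans_le (le_csSup hbdd ⟨v - w, ?_⟩)⟩
  -- The rank lemma perturbs by `+ w • B`, which is the pencil at parameter `v - w`.
  change (A - (v - w) • B).rank = _
  rw [sub_smul]
  congr 1
  abel

end Pencil

section Positivity

variable {n : ℕ} {I J : Fin n → Type*}

/-- The averaged entry is `det (-(1 - s • p))`, with `p` the mean transition matrix under `x`
against the pure profile `t`. -/
theorem sum_prod_mul_auxMatrix_zero_pos [∀ k, Fintype (I k)]
    {D : ∀ k, Fin (n + 1) → Matrix (I k) (J k) ℝ} {q : ∀ k, I k → J k → Fin n → ℝ}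
    (hq : ∀ k i j, q k i j ∈ stdSimplex ℝ (Fin n)) {s : ℝ} (hs : s ∈ Set.Ico (0 : ℝ) 1)
    (hD : ∀ k l i j, D k (Fin.succ l) i j = s * q k i j l - if l = k then 1 else 0)
    {x : ∀ k, I k → ℝ} (hx : ∀ k, x k ∈ stdSimplex ℝ (I k)) (t : ∀ k, J k) :
    0 < (-1) ^ n * ∑ s, (∏ k, x k (s k)) * auxMatrix D 0 s t := by
  let p : Matrix (Fin n) (Fin n) ℝ := Matrix.of fun k l => ∑ i, x k i * q k i (t k) l
  have hp (k) : p k ∈ stdSimplex ℝ (Fin n) := by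
    refine ⟨fun l => Finset.sum_nonneg fun i _ => mul_nonneg ((hx k).1 i) ((hq k i _).1 l), ?_⟩
    simp only [p, Matrix.of_apply]
    rw [Finset.sum_comm]
    simp only [← Finset.mul_sum, (hq k _ _).2, mul_one, (hx k).2]
  have hmat : (Matrix.of fun k l => ∑ i, x k i * D k l i (t k)).submatrix id (Fin.succAbove 0) =
      -(1 - s • p) := by
    ext k l
    simp only [Matrix.submatrix_apply, id_eq, Fin.succAbove_zero, Matrix.of_apply, hD, mul_sub,
      Finset.sum_sub_distrib, ← Finset.sum_mul, (hx k).2, one_mul, Matrix.neg_apply,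
      Matrix.sub_apply, Matrix.smul_apply, smul_eq_mul, p, Finset.mul_sum, mul_left_comm _ s,
      Matrix.one_apply, eq_comm (a := l)]
    ring
  rw [sum_prod_mul_auxMatrix, hmat, Matrix.det_neg, Fintype.card_fin]
  simp only [Fin.val_zero, pow_zero, one_mul, ← mul_assoc, ← mul_pow]
  simpa using det_one_sub_smul_pos hp hs

end Positivity

/-! ### The main theorem -/

namespace Game

variable {n : ℕ} {I J : Fin n → Type*} (Γ : Game n I J)

theorem dataArray_map {S T : Type*} [CommRing S] [Algebra ℝ S] [CommRing T] [Algebra ℝ T]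
    (f : S →ₐ[ℝ] T) (lam : S) (k : Fin n) (l : Fin (n + 1)) :
    (Γ.dataArray lam k l).map f = Γ.dataArray (f lam) k l := by
  ext i j
  refine Fin.cases ?_ (fun l => ?_) l
  · simp [dataArray]
  · simp only [dataArray, Fin.cons_succ, Matrix.map_apply, Matrix.of_apply, map_sub, map_mul,
      map_one, AlgHom.commutes]
    split_ifs <;> simp

theorem dataArray_add_sum (lam : ℝ) (v : Fin n → ℝ) (k : Fin n) (i : I k) (j : J k) :
    Γ.dataArray lam k 0 i j + ∑ l, v l * Γ.dataArray lam k l.succ i j =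
      Γ.localGame lam v k i j - v k := by
  simp only [dataArray, Fin.cons_zero, Fin.cons_succ, Matrix.of_apply, Algebra.algebraMap_self,
    RingHom.id_apply, localGame, mul_sub, Finset.sum_sub_distrib, mul_ite, mul_one, mul_zero,
    Finset.sum_ite_eq', Finset.mem_univ, if_true, Finset.mul_sum]
  simp only [mul_left_comm (v _), mul_comm (v _)]
  ring

end Game

end StochGame

theorem theorem3p4 {n : ℕ} {I J : Fin n → Type*}
    [∀ k, Fintype (I k)] [∀ k, Nonempty (I k)] [∀ k, Fintype (J k)] [∀ k, Nonempty (J k)]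
    (Γ : StochGame.Game n I J) (lam : ℝ) (hlam : lam ∈ Set.Ioc (0 : ℝ) 1)
    (m : Fin n → ℕ) (r : ∀ k, Fin (m k) ↪ I k) (c : ∀ k, Fin (m k) ↪ J k)
    (hker : ∀ k, StochGame.IsShapleySnowKernel
      (Γ.localGame lam (fun l => Γ.value lam l) k) (r k) (c k))
    (k : Fin n) :
    -- (i), for the reduced matrices and for their multiples by `(-1) ^ n`
    (∀ w : ℝ, StochGame.matVal
        (Γ.reducedDelta lam r c k.succ - w • Γ.reducedDelta lam r c 0) = 0 ↔
      w = Γ.value lam k) ∧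
    (∀ w : ℝ, StochGame.matVal
        ((-1 : ℝ) ^ n • (Γ.reducedDelta lam r c k.succ - w • Γ.reducedDelta lam r c 0)) = 0 ↔
      w = Γ.value lam k) ∧
    -- (ii)
    (∃ ρ : ℕ, IsGreatest (Set.range fun w : ℝ =>
        (Γ.reducedDelta lam r c k.succ - w • Γ.reducedDelta lam r c 0).rank) ρ ∧
      (Γ.reducedDelta lam r c k.succ - Γ.value lam k • Γ.reducedDelta lam r c 0).rank < ρ) ∧
    -- (iii), for fixed `lam` and in bivariate form
    ((Γ.charPolys lam k (Γ.reducedDelta lam r c 0).rank).Finite ∧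
      ∃ P ∈ Γ.charPolys lam k (Γ.reducedDelta lam r c 0).rank, P.eval (Γ.value lam k) = 0) ∧
    ((Γ.bivariateMinors k).Finite ∧
      ∃ P ∈ Γ.bivariateMinors k,
        P.map (Polynomial.evalRingHom lam) ∈
          Γ.charPolys lam k (Γ.reducedDelta lam r c 0).rank ∧
        (P.map (Polynomial.evalRingHom lam)).eval (Γ.value lam k) = 0) ∧
    -- (iv)
    ((∀ k' l i j, ∃ ρ : ℚ, Γ.dataArray lam k' l i j = (ρ : ℝ)) →
      IsAlgebraic ℚ (Γ.value lam k) ∧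
      (minpoly ℚ (Γ.value lam k)).natDegree ≤ (Γ.reducedDelta lam r c 0).rank) := by
  classical
  set v := Γ.value lam with hv
  choose x hx y hy hxeq hyeq using fun k => (hker k).exists_equalizing
  have hshapley (k) : StochGame.matVal (Γ.localGame lam (fun l => v l) k) = v k :=
    Γ.matVal_localGame_value hlam k
  simp only [hshapley] at hxeq hyeq
  let D : ∀ k, Fin (n + 1) → Matrix (Fin (m k)) (Fin (m k)) ℝ :=
    fun k a => (Γ.dataArray lam k a).submatrix (r k) (c k)
  have hDsum (k i j) : D k 0 i j + ∑ l, v l * D k l.succ i j =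
      Γ.localGame lam v k (r k i) (c k j) - v k := Γ.dataArray_add_sum lam v k _ _
  have hDsucc (k l i j) : D k (Fin.succ l) i j =
      (1 - lam) * (Γ.q k (r k i) (c k j)).1 l - if l = k then 1 else 0 := rfl
  have hs : 1 - lam ∈ Set.Ico (0 : ℝ) 1 := ⟨by linarith [hlam.2], by linarith [hlam.1]⟩
  have hne (k) : Nonempty (Fin (m k)) := by
    by_contra h
    rw [not_nonempty_iff] at h
    simpa using (hx k).2
  let x' : (∀ k, Fin (m k)) → ℝ := fun s => ∏ k, x k (s k)
  let y' : (∀ k, Fin (m k)) → ℝ := fun t => ∏ k, y k (t k)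
  let A := Γ.reducedDelta lam r c k.succ
  let B := Γ.reducedDelta lam r c 0
  have hx' : x' ∈ stdSimplex ℝ (∀ k, Fin (m k)) := StochGame.prod_mem_stdSimplex hx
  have hy' : y' ∈ stdSimplex ℝ (∀ k, Fin (m k)) := StochGame.prod_mem_stdSimplex hy
  have hxA (t) : ∑ s, x' s * A s t = v k * ∑ s, x' s * B s t := by
    refine StochGame.sum_prod_mul_auxMatrix_succ D x v (fun k j => ?_) k t
    simp only [hDsum, mul_sub, Finset.sum_sub_distrib, ← Finset.sum_mul, (hx k).2, one_mul]
    exact sub_eq_zero.2 (hxeq k j)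
  have htr (l s t) : StochGame.auxMatrix (fun k a => (D k a).transpose) l s t =
      StochGame.auxMatrix D l t s := by
    rw [StochGame.auxMatrix_transpose, Matrix.transpose_apply]
  have hAy (s) : ∑ t, A s t * y' t = v k * ∑ t, B s t * y' t := by
    have h := StochGame.sum_prod_mul_auxMatrix_succ (fun k a => (D k a).transpose) y v
      (fun k j => by
        simp only [Matrix.transpose_apply, hDsum, mul_comm (y k _), sub_mul,
          Finset.sum_sub_distrib, ← Finset.mul_sum, (hy k).2, mul_one]
        exact sub_eq_zero.2 (hyeq k j)) k s
    simp only [htr] at h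
    simp only [mul_comm _ (y' _)]
    exact h
  have hxB (t) : 0 < (-1) ^ n * ∑ s, x' s * B s t :=
    StochGame.sum_prod_mul_auxMatrix_zero_pos (D := D)
      (fun k i j => (Γ.q k (r k i) (c k j)).2) hs hDsucc hx t
  have hBy (s) : 0 < (-1) ^ n * ∑ t, B s t * y' t := by
    have h := StochGame.sum_prod_mul_auxMatrix_zero_pos (D := fun k a => (D k a).transpose)
      (fun k j i => (Γ.q k (r k i) (c k j)).2) hs (fun k l j i => hDsucc k l i j) hy s
    simp only [htr] at h
    simp only [mul_comm _ (y' _)]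
    exact h
  obtain ⟨ρ, hρ, hlt⟩ := StochGame.exists_isGreatest_rank_pencil hx' hxA hAy hBy
  obtain ⟨w₀, hw₀⟩ := hρ.1
  obtain ⟨r', c', hdet⟩ := StochGame.exists_submatrix_det_ne_zero _ hw₀
  let r₁ : Fin ρ ↪ ∀ k, I k := r'.trans (Function.Embedding.piCongrRight r)
  let c₁ : Fin ρ ↪ ∀ k, J k := c'.trans (Function.Embedding.piCongrRight c)
  let P {S : Type} [CommRing S] (D : ∀ k, Fin (n + 1) → Matrix (I k) (J k) S) : S[X] :=
    Matrix.det (Matrix.of fun a b => C (StochGame.auxMatrix D k.succ (r₁ a) (c₁ b)) -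
      X * C (StochGame.auxMatrix D 0 (r₁ a) (c₁ b)))
  have hPmap {S T : Type} [CommRing S] [CommRing T] (f : S →+* T)
      (D : ∀ k, Fin (n + 1) → Matrix (I k) (J k) S) :
      (P D).map f = P fun k a => (D k a).map f := by
    simp only [P, StochGame.auxMatrix_map]
    exact StochGame.map_det_pencil f _ _ _ _
  let P₀ := P (Γ.dataArray lam)
  have hred (l) : Γ.reducedDelta lam r c l = (Γ.delta lam l).submatrix
      (fun s k => r k (s k)) (fun t k => c k (t k)) := StochGame.auxMatrix_submatrix _ _ _ _
  have hPeval (w : ℝ) : P₀.eval w = ((A - w • B).submatrix r' c').det := by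
    simp only [A, B, hred]
    exact StochGame.eval_det_pencil _ _ _ _ w
  have hP0 : P₀ ≠ 0 := fun h => hdet (by
    have := hPeval w₀
    rw [h, Polynomial.eval_zero] at this
    exact this.symm)
  have hPdeg : P₀.natDegree ≤ B.rank := by
    refine le_trans ?_ (B.rank_submatrix_le r' c')
    simp only [B, hred]
    exact StochGame.natDegree_det_pencil_le _ _
  have hPv : P₀.eval (v k) = 0 := by
    rw [hPeval]
    by_contra h
    have h1 := Matrix.rank_of_det_ne_zero h
    have h2 := (A - v k • B).rank_submatrix_le r' c'
    rw [h1, Fintype.card_fin] at h2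
    exact absurd hlt h2.not_gt
  have hρpos : 0 < ρ := Nat.zero_lt_of_lt hlt
  have hPmem : P₀ ∈ Γ.charPolys lam k B.rank := ⟨⟨ρ, r₁, c₁, hρpos, rfl⟩, hP0, hPdeg⟩
  have hval {ε : ℝ} (hε : ε ≠ 0) (w : ℝ) :=
    StochGame.matVal_smul_pencil_eq_zero_iff hx' hy' hxA hAy hxB hBy hε w
  refine ⟨fun w => ?_, fun w => ?_, ⟨ρ, hρ, hlt⟩, ⟨?_, P₀, hPmem, hPv⟩, ⟨?_, ?_⟩, fun hrat => ?_⟩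
  · simpa using hval one_ne_zero w
  · exact hval (pow_ne_zero n (by norm_num)) w
  · exact (StochGame.pencilMinors_finite _ _).subset fun P hP => hP.1
  · exact StochGame.pencilMinors_finite _ _
  · have hmap : (P (Γ.dataArray (X : ℝ[X]))).map (Polynomial.evalRingHom lam) = P₀ := by
      rw [hPmap]
      congr 1
      ext k' a : 2
      have := Γ.dataArray_map (Polynomial.aeval lam) X k' a
      rw [Polynomial.aeval_X] at this
      rw [← this]
      ext i j
      simp
    exact ⟨_, ⟨ρ, r₁, c₁, hρpos, rfl⟩, hmap ▸ hPmem, hmap ▸ hPv⟩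
  · choose d hd using hrat
    have hmap : (P fun k l => Matrix.of (d k l)).map (algebraMap ℚ ℝ) = P₀ := by
      rw [hPmap]
      congr 1
      ext k' a i j
      simp [hd]
    have hne0 : (P fun k l => Matrix.of (d k l)) ≠ 0 := fun h => hP0 (by
      rw [← hmap, h, Polynomial.map_zero])
    have hroot : Polynomial.aeval (v k) (P fun k l => Matrix.of (d k l)) = 0 := by
      rw [Polynomial.aeval_def, Polynomial.eval₂_eq_eval_map, hmap, hPv]
    refine ⟨⟨_, hne0, hroot⟩, ?_⟩
    refine (Polynomial.natDegree_le_of_dvd (minpoly.dvd ℚ _ hroot) hne0).trans ?_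
    rw [← Polynomial.natDegree_map (algebraMap ℚ ℝ), hmap]
    exact hPdeg
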